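/- Let $\varphi:\mathbb R^n\to\mathbb R$ be an even convex function, and let $$\varphi^*(\xi)=\sup_{x\in\mathbb R^n}\bigl(\xi\cdot x-\varphi(x)\bigr)\in(-\infty,+\infty],\qquad \xi\in\mathbb R^n,$$ be its Legendre transform. Unless $\int_{\mathbb R^n}e^{-\varphi}=\infty$ and $\int_{\mathbb R^n}e^{-\varphi^*}=0$ (in which case the product below is the undefined expression $\infty\cdot 0$), one has $$\int_{\mathbb R^n}e^{-\varphi}\cdot\int_{\mathbb R^n}e^{-\varphi^*}\ \geq\ \pi^n .$$ The integrals are with respect to Lebesgue measure, take values in $[0,\infty]$, and $e^{-\infty}=0$. -/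

import Mathlib

open scoped ENNReal

/-- The Legendre transform `φ*(ξ) = sup_x (ξ · x - φ x)` of a real function `φ` on `ℝⁿ`.
It is taken in the extended reals, since the supremum may be `+∞`. -/
noncomputable def legendreTransform {n : ℕ} (φ : EuclideanSpace ℝ (Fin n) → ℝ)
    (ξ : EuclideanSpace ℝ (Fin n)) : EReal :=
  ⨆ x : EuclideanSpace ℝ (Fin n), ((inner ℝ ξ x - φ x : ℝ) : EReal)

/-- The integral `∫ e^{-f}` over `ℝⁿ` (Lebesgue measure) of an extended-real function `f`, with
value in `[0, ∞]`; here `e^{-∞} = 0`. -/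
noncomputable def integralExpNeg {n : ℕ} (f : EuclideanSpace ℝ (Fin n) → EReal) : ℝ≥0∞ :=
  ∫⁻ x, EReal.exp (-f x)

/-!
The proof follows Berndtsson's complex-analytic approach to the Bourgain-Milman theorem.

Let `φ` be smooth and strongly convex, with gradient `V`. The map
`(a, b) ↦ ((a - b)/2, (V a + V b)/2)` is injective, and by convexity and evenness
`φ((a - b)/2) + φ*((V a + V b)/2) ≤ (a · V a + b · V b)/2`. Hence
`∫ e^{-φ} ∫ e^{-φ*} ≥ 4⁻ⁿ ∫∫ e^{-(a · V a + b · V b)/2} |det (DV(a) + DV(b))| da db`.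
The last integrand is the absolute value of the pull-back of the holomorphic form
`e^{-z · w/2} dz ∧ dw` under `(a, b) ↦ (a + ib, V a - iV b)`, and the integral of such a pull-back
does not change when `V` is deformed to the identity, where it is a Gaussian integral of modulus
`(4π)ⁿ`. This gives the constant `πⁿ`.

To avoid Stokes' theorem, the deformation is carried out by analytic continuation. The Cayley
transform `R` of `V` (`exists_cayley_transform`) parametrizes the graph of `V` by
`a = p + R p`, `V a = p - R p`, with `|R p - R p'| < |p - p'|`. In these coordinates the form above is,
up to a constant factor, the value at `s = i` of the pull-back of the Gaussian `e^{-(|p|² + |q|²)/2} dp dq` under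
`(p, q) ↦ (p + s R q, q - s R p)`. For small real `s` this is a change of variables of `ℝ²ⁿ`, so the
integral is `(2π)ⁿ` (`exists_integral_twistedGaussian_ofReal`); it is holomorphic in `s` for
`|Re s| + |Im s| < 1`, hence constant there (`integral_twistedGaussian`), and one lets `s → i` along
the imaginary axis (`two_pi_pow_le_lintegral_det`). The estimate for strongly convex functions is
`pi_pow_le_of_strongly_convex`.

A general `φ` is approximated by its mollifications plus `ε |x|²`. These are at least `φ` by Jensen's
inequality, so `∫ e^{-φ}` does not increase, while `∫ e^{-φ*}` is upper semicontinuous along the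
approximation (`limsup_integralExpNeg_legendreTransform_le`).
-/

open MeasureTheory Set Filter Topology Metric
open scoped Convolution

/-! ### Determinants of block operators and of `1 + t X` -/

section BlockDeterminants

variable {E : Type*} [NormedAddCommGroup E] [InnerProductSpace ℝ E]

/-- The operator on `E × E` with block matrix `[[A, B], [C, D]]`. -/
noncomputable def blockCLM (A B C D : E →L[ℝ] E) : E × E →L[ℝ] E × E :=
  (A.coprod B).prod (C.coprod D)

@[simp] lemma blockCLM_apply (A B C D : E →L[ℝ] E) (z : E × E) :
    blockCLM A B C D z = (A z.1 + B z.2, C z.1 + D z.2) := rfl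

variable [FiniteDimensional ℝ E]

/-- The matrix of an operator in the standard orthonormal basis. -/
noncomputable def stdMatrix (X : E →L[ℝ] E) :
    Matrix (Fin (Module.finrank ℝ E)) (Fin (Module.finrank ℝ E)) ℝ :=
  LinearMap.toMatrix (stdOrthonormalBasis ℝ E).toBasis (stdOrthonormalBasis ℝ E).toBasis
    X.toLinearMap

lemma det_stdMatrix (X : E →L[ℝ] E) : (stdMatrix X).det = X.det := by
  simp [stdMatrix, ContinuousLinearMap.det, LinearMap.det_toMatrix]

lemma continuous_stdMatrix : Continuous (stdMatrix : (E →L[ℝ] E) → _) := by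
  refine continuous_matrix fun i j => ?_
  simp only [stdMatrix, LinearMap.toMatrix_apply]
  simp only [OrthonormalBasis.coe_toBasis, ContinuousLinearMap.coe_coe,
    OrthonormalBasis.coe_toBasis_repr_apply, OrthonormalBasis.repr_apply_apply]
  fun_prop

lemma stdMatrix_one : stdMatrix (1 : E →L[ℝ] E) = 1 := by
  simp only [stdMatrix, ContinuousLinearMap.toLinearMap_one, LinearMap.toMatrix_one]

lemma stdMatrix_add (X Y : E →L[ℝ] E) : stdMatrix (X + Y) = stdMatrix X + stdMatrix Y := by
  simp [stdMatrix]

lemma stdMatrix_smul (c : ℝ) (X : E →L[ℝ] E) : stdMatrix (c • X) = c • stdMatrix X := by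
  simp [stdMatrix]

lemma stdMatrix_neg (X : E →L[ℝ] E) : stdMatrix (-X) = -stdMatrix X := by
  simp [stdMatrix]

lemma stdMatrix_mul (X Y : E →L[ℝ] E) : stdMatrix (X * Y) = stdMatrix X * stdMatrix Y := by
  rw [stdMatrix, ContinuousLinearMap.toLinearMap_mul, LinearMap.toMatrix_mul]; rfl

lemma det_blockCLM (A B C D : E →L[ℝ] E) :
    (blockCLM A B C D).det
      = (Matrix.fromBlocks (stdMatrix A) (stdMatrix B) (stdMatrix C) (stdMatrix D)).det := by
  rw [ContinuousLinearMap.det, ← LinearMap.det_toMatrix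
    ((stdOrthonormalBasis ℝ E).toBasis.prod (stdOrthonormalBasis ℝ E).toBasis)]
  congr 1
  ext i j
  rcases i with i | i <;> rcases j with j | j <;>
    simp [LinearMap.toMatrix_apply, stdMatrix]

lemma det_blockCLM_one_one (X Y : E →L[ℝ] E) :
    (blockCLM 1 X Y 1).det = (1 - Y * X).det := by
  rw [det_blockCLM, stdMatrix_one, Matrix.det_fromBlocks_one₁₁, ← stdMatrix_mul, ← stdMatrix_one,
    sub_eq_add_neg, ← stdMatrix_neg, ← stdMatrix_add, det_stdMatrix, sub_eq_add_neg]

/-- The map `(u, v) ↦ ((u - v)/2, (u + v)/2)`, a rotation by `π/4` followed by a homothety of ratio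
`1/√2`, has Jacobian `2⁻ⁿ`. -/
lemma det_blockCLM_rotation :
    (blockCLM ((1 / 2 : ℝ) • 1) (-((1 / 2 : ℝ) • 1)) ((1 / 2 : ℝ) • 1)
      ((1 / 2 : ℝ) • (1 : E →L[ℝ] E))).det = (1 / 2) ^ Module.finrank ℝ E := by
  rw [det_blockCLM, stdMatrix_neg, stdMatrix_smul, stdMatrix_one, ← smul_neg,
    ← Matrix.fromBlocks_smul, Matrix.det_smul, Matrix.det_fromBlocks_one₁₁]
  have h : (1 : Matrix (Fin (Module.finrank ℝ E)) (Fin (Module.finrank ℝ E)) ℝ) - 1 * -1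
      = (2 : ℝ) • 1 := by
    rw [mul_neg, mul_one, sub_neg_eq_add, two_smul]
  rw [h, Matrix.det_smul, Matrix.det_one, Fintype.card_sum, Fintype.card_fin, pow_add, mul_one,
    mul_assoc, ← mul_pow]
  norm_num

/-- The determinant of `1 + t X` at a complex parameter `t`, for a real operator `X`: it is computed
from the matrix of `X`, with entries viewed as complex numbers. -/
noncomputable def complexDet (X : E →L[ℝ] E) (t : ℂ) : ℂ :=
  (1 + t • (stdMatrix X).map Complex.ofReal).det

lemma complexDet_ofReal (X : E →L[ℝ] E) (t : ℝ) :
    complexDet X t = ((1 + t • X).det : ℝ) := by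
  rw [← det_stdMatrix, stdMatrix_add, stdMatrix_one, stdMatrix_smul, complexDet,
    ← Complex.ofRealHom_eq_coe (Matrix.det _), RingHom.map_det]
  congr 1
  ext i j
  simp [Matrix.one_apply, apply_ite]

lemma differentiable_complexDet (X : E →L[ℝ] E) : Differentiable ℂ (complexDet X) := by
  unfold complexDet
  simp only [Matrix.det_apply, Matrix.add_apply, Matrix.smul_apply]
  fun_prop

lemma continuous_complexDet :
    Continuous fun z : (E →L[ℝ] E) × ℂ => complexDet z.1 z.2 := by
  unfold complexDet
  have := continuous_stdMatrix (E := E)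
  refine Continuous.matrix_det ?_
  refine continuous_const.add (continuous_snd.smul ?_)
  exact (this.comp continuous_fst).matrix_map Complex.continuous_ofReal

/-- A uniform bound, by compactness of the unit balls. -/
lemma exists_norm_complexDet_le :
    ∃ K : ℝ, ∀ X : E →L[ℝ] E, ‖X‖ ≤ 1 → ∀ t : ℂ, ‖t‖ ≤ 1 → ‖complexDet X t‖ ≤ K := by
  obtain ⟨K, hK⟩ := ((isCompact_closedBall (0 : E →L[ℝ] E) 1).prod
    (isCompact_closedBall (0 : ℂ) 1)).exists_bound_of_continuousOn
      (continuous_complexDet (E := E)).continuousOn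
  refine ⟨K, fun X hX t ht => hK (X, t) ⟨?_, ?_⟩⟩ <;> simpa

lemma exists_det_one_add_pos :
    ∃ δ : ℝ, 0 < δ ∧ ∀ X : E →L[ℝ] E, ‖X‖ < δ → 0 < (1 + X).det := by
  have hc : Continuous fun X : E →L[ℝ] E => (1 + X).det := by
    simp only [← det_stdMatrix]
    exact (continuous_stdMatrix.comp (continuous_const.add continuous_id)).matrix_det
  have h := hc.tendsto 0
  have h0 : (0 : ℝ) < (1 + (0 : E →L[ℝ] E)).det := by
    simp [← det_stdMatrix, stdMatrix_one]
  obtain ⟨δ, hδ, h⟩ := Metric.mem_nhds_iff.1 (h.eventually (lt_mem_nhds h0))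
  exact ⟨δ, hδ, fun X hX => h (by simpa using hX)⟩

end BlockDeterminants

/-! ### Integrals depending holomorphically on a parameter -/

section HolomorphicParameter

/-- A parametric integral of functions holomorphic in the parameter is holomorphic; the derivative
of the integrand is controlled by Cauchy's estimate. -/
lemma differentiableAt_integral_of_norm_le {α : Type*} [TopologicalSpace α] [MeasurableSpace α]
    [OpensMeasurableSpace α] {μ : Measure α} {F : α → ℂ → ℂ}
    (hF : Continuous (Function.uncurry F)) (hdiff : ∀ a, Differentiable ℂ (F a))
    {s₀ : ℂ} {r : ℝ} (hr : 0 < r) {g : α → ℝ} (hg : Integrable g μ)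
    (hbound : ∀ a, ∀ s ∈ ball s₀ r, ‖F a s‖ ≤ g a) :
    DifferentiableAt ℂ (fun s => ∫ a, F a s ∂μ) s₀ := by
  have hmeas : ∀ s, AEStronglyMeasurable (fun a => F a s) μ := fun s =>
    (Measurable.stronglyMeasurable
      (hF.comp (continuous_id.prodMk continuous_const)).measurable).aestronglyMeasurable
  have hder : AEStronglyMeasurable (fun a => deriv (F a) s₀) μ :=
    ((measurable_deriv_with_param hF).comp
      (measurable_id.prodMk measurable_const)).stronglyMeasurable.aestronglyMeasurable
  have key := hasDerivAt_integral_of_dominated_loc_of_deriv_le (μ := μ)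
    (F := fun s a => F a s) (F' := fun s a => deriv (F a) s) (x₀ := s₀)
    (s := ball s₀ (r / 2)) (bound := fun a => g a / (r / 2 / 2))
    (ball_mem_nhds s₀ (by positivity)) (Eventually.of_forall hmeas)
    (hg.mono' (hmeas s₀) (Eventually.of_forall fun a => hbound a s₀ (mem_ball_self hr)))
    hder (Eventually.of_forall fun a s hs => ?_) (hg.div_const _)
    (Eventually.of_forall fun a s _ => (hdiff a s).hasDerivAt)
  · exact key.2.differentiableAt
  · refine Complex.norm_deriv_le_of_forall_mem_sphere_norm_le (by positivity)
      (hdiff a).diffContOnCl fun z hz => hbound a z ?_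
    rw [mem_ball] at hs ⊢
    rw [mem_sphere] at hz
    linarith [dist_triangle z s s₀]

end HolomorphicParameter

/-! ### Gaussian and exponential integrals -/

section Gaussian

variable {E : Type*} [NormedAddCommGroup E] [InnerProductSpace ℝ E] [FiniteDimensional ℝ E]
  [MeasurableSpace E] [BorelSpace E]

lemma integrable_exp_neg_mul_sq_norm {b : ℝ} (hb : 0 < b) :
    Integrable fun v : E => Real.exp (-b * ‖v‖ ^ 2) := by
  have h := (GaussianFourier.integrable_cexp_neg_mul_sq_norm_add (V := E) (b := (b : ℂ))
    (by simpa using hb) 0 0).norm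
  refine h.congr (Eventually.of_forall fun v => ?_)
  simp only [Complex.norm_exp]
  congr 1
  norm_cast
  simp

lemma integrable_exp_neg_mul_sq_norm_prod {b : ℝ} (hb : 0 < b) :
    Integrable fun z : E × E => Real.exp (-b * (‖z.1‖ ^ 2 + ‖z.2‖ ^ 2)) := by
  refine ((integrable_exp_neg_mul_sq_norm (E := E) hb).mul_prod
    (integrable_exp_neg_mul_sq_norm (E := E) hb)).congr (Eventually.of_forall fun z => ?_)
  simp only [← Real.exp_add]
  ring_nf

lemma integral_exp_neg_half_sq_norm_prod :
    ∫ z : E × E, Real.exp (-(‖z.1‖ ^ 2 + ‖z.2‖ ^ 2) / 2)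
      = (2 * Real.pi) ^ Module.finrank ℝ E := by
  have h : ∀ z : E × E, Real.exp (-(‖z.1‖ ^ 2 + ‖z.2‖ ^ 2) / 2)
      = Real.exp (-(1 / 2) * ‖z.1‖ ^ 2) * Real.exp (-(1 / 2) * ‖z.2‖ ^ 2) := fun z => by
    rw [← Real.exp_add]; ring_nf
  simp_rw [h]
  rw [Measure.volume_eq_prod, integral_prod_mul (fun v : E => Real.exp (-(1 / 2) * ‖v‖ ^ 2))
    (fun v : E => Real.exp (-(1 / 2) * ‖v‖ ^ 2)),
    GaussianFourier.integral_rexp_neg_mul_sq_norm (by norm_num : (0 : ℝ) < 1 / 2),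
    ← Real.rpow_add (by positivity), add_halves, Real.rpow_natCast]
  congr 1
  ring

lemma integrable_exp_neg_mul_norm {c : ℝ} (hc : 0 < c) :
    Integrable fun v : E => Real.exp (-(c * ‖v‖)) := by
  set m := Module.finrank ℝ E + 1
  have h := integrable_one_add_norm (E := E) (μ := volume) (r := (m : ℝ)) (by simp [m])
  -- `(c (1 + t))^m / m! ≤ e^{c (1 + t)}`
  refine (h.const_mul (Real.exp c * m.factorial / c ^ m)).mono'
    (by fun_prop) (Eventually.of_forall fun v => ?_)
  have hv : 0 < 1 + ‖v‖ := by positivity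
  have h1 := Real.pow_div_factorial_le_exp (c * (1 + ‖v‖)) (by positivity) m
  rw [Real.norm_of_nonneg (Real.exp_nonneg _), Real.rpow_neg hv.le, Real.rpow_natCast,
    Real.exp_neg]
  have h2 : Real.exp (c * (1 + ‖v‖)) = Real.exp c * Real.exp (c * ‖v‖) := by
    rw [← Real.exp_add]; ring_nf
  rw [h2, mul_pow, div_le_iff₀ (by positivity)] at h1
  rw [inv_le_iff_one_le_mul₀ (Real.exp_pos _), ← div_eq_mul_inv, div_div, div_mul_eq_mul_div,
    le_div_iff₀ (by positivity)]
  linarith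

end Gaussian

/-! ### The twisted Gaussian integral -/

section TwistedGaussian

variable {E : Type*} [NormedAddCommGroup E] [InnerProductSpace ℝ E]

/-- The map `(p, q) ↦ (p + s R q, q + t R p)`. -/
def twistMap (R : E → E) (s t : ℝ) (z : E × E) : E × E := (z.1 + s • R z.2, z.2 + t • R z.1)

/-- `twistMap R s (-s)` is a contractive perturbation of the identity. -/
lemma bijective_twistMap [CompleteSpace E] {R : E → E} (hlip : LipschitzWith 1 R) {s : ℝ}
    (hs : |s| < 1) :
    Function.Bijective (twistMap R s (-s)) := by
  have happ : ApproximatesLinearOn (twistMap R s (-s))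
      ((ContinuousLinearEquiv.refl ℝ (E × E) : (E × E) ≃L[ℝ] E × E) : E × E →L[ℝ] E × E)
      univ ‖s‖₊ := by
    intro x _ y _
    have h : twistMap R s (-s) x - twistMap R s (-s) y
        - ((ContinuousLinearEquiv.refl ℝ (E × E) : (E × E) ≃L[ℝ] E × E) : E × E →L[ℝ] E × E) (x - y)
        = s • (R x.2 - R y.2, R y.1 - R x.1) := by
      ext <;> simp [twistMap, smul_sub] <;> abel
    rw [h, norm_smul, coe_nnnorm]
    refine mul_le_mul_of_nonneg_left ?_ (norm_nonneg s)
    have h1 := hlip.dist_le_mul x.1 y.1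
    have h2 := hlip.dist_le_mul x.2 y.2
    rw [dist_eq_norm, dist_eq_norm, NNReal.coe_one, one_mul] at h1 h2
    rw [Prod.norm_def]
    refine max_le (h2.trans (norm_snd_le (x - y))) ?_
    rw [norm_sub_rev]
    exact h1.trans (norm_fst_le (x - y))
  have hc : Subsingleton (E × E) ∨ ‖s‖₊ < ‖((ContinuousLinearEquiv.refl ℝ (E × E)).symm :
      E × E →L[ℝ] E × E)‖₊⁻¹ := by
    rcases subsingleton_or_nontrivial (E × E) with h | h
    · exact Or.inl h
    · right
      have h1 : ‖((ContinuousLinearEquiv.refl ℝ (E × E)).symm : E × E →L[ℝ] E × E)‖₊ = 1 :=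
        NNReal.coe_injective ContinuousLinearMap.norm_id
      rw [h1, inv_one, ← NNReal.coe_lt_coe]
      simpa using hs
  exact ⟨injOn_univ.1 (happ.injOn hc), happ.surjective hc⟩

lemma hasFDerivAt_twistMap {R : E → E} (hR : Differentiable ℝ R) (s t : ℝ) (z : E × E) :
    HasFDerivAt (twistMap R s t)
      (blockCLM 1 (s • fderiv ℝ R z.2) (t • fderiv ℝ R z.1) 1) z := by
  have h1 : HasFDerivAt (fun z : E × E => R z.1)
      ((fderiv ℝ R z.1).comp (ContinuousLinearMap.fst ℝ E E)) z :=
    (hR z.1).hasFDerivAt.comp z hasFDerivAt_fst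
  have h2 : HasFDerivAt (fun z : E × E => R z.2)
      ((fderiv ℝ R z.2).comp (ContinuousLinearMap.snd ℝ E E)) z :=
    (hR z.2).hasFDerivAt.comp z hasFDerivAt_snd
  have h3 := ((hasFDerivAt_fst (𝕜 := ℝ) (p := z)).add (h2.const_smul s)).prodMk
    ((hasFDerivAt_snd (𝕜 := ℝ) (p := z)).add (h1.const_smul t))
  refine h3.congr_fderiv ?_
  ext v <;> simp [blockCLM]

variable [FiniteDimensional ℝ E]

/-- The pull-back of the Gaussian density `e^{-(|p|² + |q|²)/2} dp dq` under
`twistMap R s (-s) : (p, q) ↦ (p + s R q, q - s R p)`, expanded into an expression that makes sense,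
and is entire, for complex `s`. -/
noncomputable def twistedGaussian (R : E → E) (z : E × E) (s : ℂ) : ℂ :=
  Complex.exp (-(((‖z.1‖ ^ 2 + ‖z.2‖ ^ 2 : ℝ) : ℂ) + s ^ 2 * ((‖R z.1‖ ^ 2 + ‖R z.2‖ ^ 2 : ℝ) : ℂ)
    + 2 * s * ((inner ℝ z.1 (R z.2) - inner ℝ z.2 (R z.1) : ℝ) : ℂ)) / 2)
  * complexDet (fderiv ℝ R z.1 * fderiv ℝ R z.2) (s ^ 2)

lemma continuous_twistedGaussian {R : E → E} (hR : ContDiff ℝ 1 R) :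
    Continuous (Function.uncurry (twistedGaussian R)) := by
  have h1 : Continuous (fderiv ℝ R) := hR.continuous_fderiv one_ne_zero
  have h2 : Continuous R := hR.continuous
  unfold twistedGaussian Function.uncurry
  refine Continuous.mul (by fun_prop) ?_
  exact continuous_complexDet.comp (Continuous.prodMk (by fun_prop) (by fun_prop))

lemma differentiable_twistedGaussian (R : E → E) (z : E × E) :
    Differentiable ℂ (twistedGaussian R z) := by
  have := (differentiable_complexDet (fderiv ℝ R z.1 * fderiv ℝ R z.2))
  unfold twistedGaussian
  fun_prop

/-- Lower bound for the real part of `|p + s R q|² + |q - s R p|²`, where `s = x + iy`; here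
`a² = |p|² + |q|²`, `b² = |R p|² + |R q|²` and `w = p · R q - q · R p`. -/
lemma twist_quadratic_bound {a b w x y : ℝ} (hb : 0 ≤ b) (hab : b ≤ a) (hw : |w| ≤ a * b)
    (hx : |x| ≤ 1) :
    ((1 - |x|) ^ 2 - y ^ 2) * a ^ 2 ≤ a ^ 2 + (x ^ 2 - y ^ 2) * b ^ 2 + 2 * x * w := by
  have h1 : -(|x| * (a * b)) ≤ x * w := by
    have := neg_abs_le (x * w)
    rw [abs_mul] at this
    nlinarith [mul_le_mul_of_nonneg_left hw (abs_nonneg x)]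
  have h2 : ((1 - |x|) * a) ^ 2 ≤ (a - |x| * b) ^ 2 := by
    have h := mul_le_mul_of_nonneg_left hab (abs_nonneg x)
    refine pow_le_pow_left₀ (mul_nonneg (by linarith) (by linarith)) (by linarith) 2
  have h3 : y ^ 2 * b ^ 2 ≤ y ^ 2 * a ^ 2 :=
    mul_le_mul_of_nonneg_left (pow_le_pow_left₀ hb hab 2) (sq_nonneg y)
  have h4 : x ^ 2 = |x| ^ 2 := (sq_abs x).symm
  rw [h4]
  nlinarith

/-- In the domain `|Re s| + |Im s| < 1` the twisted Gaussian is locally uniformly dominated by a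
Gaussian. -/
lemma norm_twistedGaussian_le {R : E → E} (h0 : R 0 = 0) (hlip : LipschitzWith 1 R) {K : ℝ}
    (hK : ∀ X : E →L[ℝ] E, ‖X‖ ≤ 1 → ∀ t : ℂ, ‖t‖ ≤ 1 → ‖complexDet X t‖ ≤ K)
    {s : ℂ} {ρ : ℝ} (hρ : ρ ≤ 1) (hs : |s.re| + |s.im| ≤ ρ) (z : E × E) :
    ‖twistedGaussian R z s‖
      ≤ Real.exp (-((1 - ρ) ^ 2 / 2) * (‖z.1‖ ^ 2 + ‖z.2‖ ^ 2)) * K := by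
  have hR : ∀ v, ‖R v‖ ≤ ‖v‖ := fun v => by
    simpa [h0] using hlip.dist_le_mul v 0
  have hD : ∀ v, ‖fderiv ℝ R v‖ ≤ 1 := fun v => norm_fderiv_le_of_lipschitz ℝ hlip
  have hns : ‖s‖ ≤ 1 := ((Complex.norm_le_abs_re_add_abs_im s).trans hs).trans hρ
  rw [twistedGaussian, norm_mul]
  refine mul_le_mul ?_ (hK _ ?_ _ ?_) (norm_nonneg _) (Real.exp_nonneg _)
  · rw [Complex.norm_exp, Real.exp_le_exp]
    set X := ‖z.1‖ ^ 2 + ‖z.2‖ ^ 2 with hX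
    set Y := ‖R z.1‖ ^ 2 + ‖R z.2‖ ^ 2 with hY
    set W := inner ℝ z.1 (R z.2) - inner ℝ z.2 (R z.1) with hW
    have hre : (-((X : ℂ) + s ^ 2 * (Y : ℂ) + 2 * s * (W : ℂ)) / 2).re
        = -(X + (s.re ^ 2 - s.im ^ 2) * Y + 2 * s.re * W) / 2 := by
      simp [pow_two]
    rw [hre]
    have hX0 : 0 ≤ X := by positivity
    have hY0 : 0 ≤ Y := by positivity
    have hYX : Y ≤ X := add_le_add (pow_le_pow_left₀ (norm_nonneg _) (hR _) 2)
      (pow_le_pow_left₀ (norm_nonneg _) (hR _) 2)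
    have hWXY : |W| ≤ √X * √Y := by
      rw [← Real.sqrt_mul hX0]
      refine Real.le_sqrt_of_sq_le ?_
      have h1 : |W| ≤ ‖z.1‖ * ‖R z.2‖ + ‖z.2‖ * ‖R z.1‖ :=
        (abs_sub _ _).trans (add_le_add (abs_real_inner_le_norm _ _) (abs_real_inner_le_norm _ _))
      refine (pow_le_pow_left₀ (abs_nonneg _) h1 2).trans ?_
      rw [hX, hY]
      nlinarith [sq_nonneg (‖z.1‖ * ‖R z.1‖ - ‖z.2‖ * ‖R z.2‖)]
    have hx := abs_nonneg s.re
    have hy := abs_nonneg s.im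
    have key := twist_quadratic_bound (y := s.im) (x := s.re) (Real.sqrt_nonneg Y)
      (Real.sqrt_le_sqrt hYX) hWXY (by linarith)
    rw [Real.sq_sqrt hX0, Real.sq_sqrt hY0] at key
    have h2 : (1 - ρ) ^ 2 ≤ (1 - |s.re|) ^ 2 - s.im ^ 2 := by
      rw [← sq_abs s.im]
      nlinarith
    have := mul_le_mul_of_nonneg_right h2 hX0
    linarith
  · calc _ ≤ ‖fderiv ℝ R z.1‖ * ‖fderiv ℝ R z.2‖ := norm_mul_le _ _
      _ ≤ 1 * 1 := mul_le_mul (hD _) (hD _) (norm_nonneg _) zero_le_one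
      _ = 1 := one_mul 1
  · rw [norm_pow]
    exact pow_le_one₀ (norm_nonneg _) hns

lemma norm_twistedGaussian_mul_I (R : E → E) (z : E × E) (σ : ℝ) :
    ‖twistedGaussian R z (σ * Complex.I)‖
      = Real.exp (-((‖z.1‖ ^ 2 + ‖z.2‖ ^ 2) - σ ^ 2 * (‖R z.1‖ ^ 2 + ‖R z.2‖ ^ 2)) / 2)
        * |(1 - σ ^ 2 • (fderiv ℝ R z.1 * fderiv ℝ R z.2)).det| := by
  have h : ((σ : ℂ) * Complex.I) ^ 2 = ((-σ ^ 2 : ℝ) : ℂ) := by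
    rw [mul_pow, Complex.I_sq]; push_cast; ring
  rw [twistedGaussian, h, complexDet_ofReal, norm_mul, Complex.norm_exp, Complex.norm_real,
    Real.norm_eq_abs, neg_smul, ← sub_eq_add_neg]
  congr 2
  simp [-Complex.ofReal_add, -Complex.ofReal_sub, -Complex.ofReal_pow, pow_two]
  ring

variable [MeasurableSpace E] [BorelSpace E]

/-- For small real `s` the integral of the twisted Gaussian is computed by the change of
variables `twistMap R s`. -/
lemma exists_integral_twistedGaussian_ofReal {R : E → E} (hR : ContDiff ℝ 1 R)
    (hlip : LipschitzWith 1 R) :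
    ∃ δ : ℝ, 0 < δ ∧ ∀ s : ℝ, |s| < δ →
      ∫ z, twistedGaussian R z s = (((2 * Real.pi) ^ Module.finrank ℝ E : ℝ) : ℂ) := by
  obtain ⟨δ, hδ, hdet⟩ := exists_det_one_add_pos (E := E)
  refine ⟨min 1 δ, lt_min one_pos hδ, fun s hs => ?_⟩
  have hs1 : |s| < 1 := hs.trans_le (min_le_left _ _)
  have hbij := bijective_twistMap hlip hs1
  have : (volume : Measure (E × E)).IsAddHaarMeasure := by
    rw [Measure.volume_eq_prod]; infer_instance
  have hcv := integral_image_eq_integral_abs_det_fderiv_smul (volume : Measure (E × E))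
    MeasurableSet.univ
    (fun z _ => (hasFDerivAt_twistMap (hR.differentiable one_ne_zero) s (-s) z).hasFDerivWithinAt)
    hbij.injective.injOn (fun z => Real.exp (-(‖z.1‖ ^ 2 + ‖z.2‖ ^ 2) / 2))
  rw [image_univ, hbij.surjective.range_eq, setIntegral_univ, setIntegral_univ,
    integral_exp_neg_half_sq_norm_prod] at hcv
  rw [hcv, ← integral_complex_ofReal]
  refine integral_congr_ae (Eventually.of_forall fun z => ?_)
  have hD : ∀ v, ‖fderiv ℝ R v‖ ≤ 1 := fun v => norm_fderiv_le_of_lipschitz ℝ hlip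
  have hdeteq : (blockCLM 1 (s • fderiv ℝ R z.2) (-s • fderiv ℝ R z.1) 1).det
      = (1 + s ^ 2 • (fderiv ℝ R z.1 * fderiv ℝ R z.2)).det := by
    rw [det_blockCLM_one_one, neg_smul, neg_mul, sub_neg_eq_add, smul_mul_smul_comm, pow_two]
  have hpos : 0 < (1 + s ^ 2 • (fderiv ℝ R z.1 * fderiv ℝ R z.2)).det := by
    refine hdet _ ?_
    have h1 : ‖fderiv ℝ R z.1 * fderiv ℝ R z.2‖ ≤ 1 := (norm_mul_le _ _).trans
      (mul_le_one₀ (hD _) (norm_nonneg _) (hD _))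
    have h2 : s ^ 2 ≤ |s| := by
      rw [← sq_abs]; nlinarith [abs_nonneg s]
    rw [norm_smul, Real.norm_of_nonneg (sq_nonneg s)]
    calc s ^ 2 * _ ≤ s ^ 2 * 1 := mul_le_mul_of_nonneg_left h1 (sq_nonneg s)
      _ ≤ |s| := by linarith
      _ < δ := hs.trans_le (min_le_right _ _)
  simp only [hdeteq, abs_of_pos hpos, smul_eq_mul, Complex.ofReal_mul]
  rw [twistedGaussian, ← Complex.ofReal_pow, complexDet_ofReal, mul_comm]
  congr 1
  rw [Complex.ofReal_exp]
  congr 1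
  norm_cast
  simp only [twistMap]
  rw [norm_add_sq_real, norm_add_sq_real, norm_smul, norm_smul, mul_pow, mul_pow, inner_smul_right,
    inner_smul_right, Real.norm_eq_abs, Real.norm_eq_abs, sq_abs, sq_abs]
  ring

lemma convex_abs_re_add_abs_im_lt : Convex ℝ {s : ℂ | |s.re| + |s.im| < 1} := by
  have h1 : ConvexOn ℝ univ fun s : ℂ => |s.re| :=
    (convexOn_norm convex_univ).comp_linearMap Complex.reLm
  have h2 : ConvexOn ℝ univ fun s : ℂ => |s.im| :=
    (convexOn_norm convex_univ).comp_linearMap Complex.imLm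
  simpa using (h1.add h2).convex_lt 1

/-- The integral of the twisted Gaussian does not depend on the parameter, by analytic
continuation from small real parameters. -/
lemma integral_twistedGaussian {R : E → E} (hR : ContDiff ℝ 1 R) (h0 : R 0 = 0)
    (hlip : LipschitzWith 1 R) {s : ℂ} (hs : |s.re| + |s.im| < 1) :
    ∫ z, twistedGaussian R z s = (((2 * Real.pi) ^ Module.finrank ℝ E : ℝ) : ℂ) := by
  obtain ⟨K, hK⟩ := exists_norm_complexDet_le (E := E)
  set U : Set ℂ := {s : ℂ | |s.re| + |s.im| < 1}
  have hcont : Continuous fun s : ℂ => |s.re| + |s.im| := by fun_prop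
  have hU : IsOpen U := isOpen_lt hcont continuous_const
  have hdiff : DifferentiableOn ℂ (fun s => ∫ z, twistedGaussian R z s) U := by
    intro s₀ hs₀
    obtain ⟨ρ, hρ, hρ1⟩ := exists_between (show |s₀.re| + |s₀.im| < 1 from hs₀)
    obtain ⟨r, hr, hball⟩ := Metric.isOpen_iff.1 (isOpen_lt hcont continuous_const) s₀ hρ
    refine (differentiableAt_integral_of_norm_le (continuous_twistedGaussian hR)
      (differentiable_twistedGaussian R) hr
      ((integrable_exp_neg_mul_sq_norm_prod (E := E) (b := (1 - ρ) ^ 2 / 2) ?_).mul_const K)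
      fun z s hs => norm_twistedGaussian_le h0 hlip hK hρ1.le (hball hs).le z
      ).differentiableWithinAt
    have : 0 < 1 - ρ := by linarith
    positivity
  obtain ⟨δ, hδ, hreal⟩ := exists_integral_twistedGaussian_ofReal hR hlip
  refine (hdiff.analyticOnNhd hU).eqOn_of_preconnected_of_frequently_eq
    (g := fun _ => (((2 * Real.pi) ^ Module.finrank ℝ E : ℝ) : ℂ)) analyticOnNhd_const
    convex_abs_re_add_abs_im_lt.isPreconnected (z₀ := 0) (by simp [U]) ?_ hs
  have ht : Tendsto (fun x : ℝ => (x : ℂ)) (𝓝[≠] 0) (𝓝[≠] 0) := by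
    refine tendsto_nhdsWithin_iff.2 ⟨?_, ?_⟩
    · exact (Complex.continuous_ofReal.tendsto' 0 0 (by simp)).mono_left nhdsWithin_le_nhds
    · filter_upwards [self_mem_nhdsWithin] with x hx
      simpa using hx
  refine ht.frequently (Eventually.frequently ?_)
  filter_upwards [nhdsWithin_le_nhds (ball_mem_nhds (0 : ℝ) hδ)] with x hx
  exact hreal x (by simpa using hx)

/-- The boundary case `s = i` of `integral_twistedGaussian`, in absolute value. The Gaussian bound
degenerates as `s → i`, and the growth assumption on `|p|² - |R p|²` provides the domination. -/
theorem two_pi_pow_le_lintegral_det {R : E → E} (hR : ContDiff ℝ 1 R) (h0 : R 0 = 0)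
    (hlip : LipschitzWith 1 R) {c C : ℝ} (hc : 0 < c)
    (hgrowth : ∀ p, c * ‖p‖ - C ≤ ‖p‖ ^ 2 - ‖R p‖ ^ 2) :
    ENNReal.ofReal ((2 * Real.pi) ^ Module.finrank ℝ E) ≤
      ∫⁻ z : E × E, ENNReal.ofReal
        (Real.exp (-((‖z.1‖ ^ 2 - ‖R z.1‖ ^ 2) + (‖z.2‖ ^ 2 - ‖R z.2‖ ^ 2)) / 2)
          * |(1 - fderiv ℝ R z.1 * fderiv ℝ R z.2).det|) := by
  obtain ⟨K, hK⟩ := exists_norm_complexDet_le (E := E)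
  have hbound : ∀ σ ∈ Ioo (0 : ℝ) 1, ∀ z, ‖twistedGaussian R z (σ * Complex.I)‖
      ≤ Real.exp C * K * (Real.exp (-(c / 2 * ‖z.1‖)) * Real.exp (-(c / 2 * ‖z.2‖))) := by
    intro σ hσ z
    have hD : ∀ v, ‖fderiv ℝ R v‖ ≤ 1 := fun v => norm_fderiv_le_of_lipschitz ℝ hlip
    have hσ2 : σ ^ 2 ≤ 1 := pow_le_one₀ hσ.1.le hσ.2.le
    have hdet : |(1 - σ ^ 2 • (fderiv ℝ R z.1 * fderiv ℝ R z.2)).det| ≤ K := by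
      have h := hK (fderiv ℝ R z.1 * fderiv ℝ R z.2)
        ((norm_mul_le _ _).trans (mul_le_one₀ (hD _) (norm_nonneg _) (hD _)))
        ((-σ ^ 2 : ℝ) : ℂ) (by
          rwa [Complex.norm_real, norm_neg, Real.norm_of_nonneg (sq_nonneg σ)])
      rwa [complexDet_ofReal, Complex.norm_real, Real.norm_eq_abs, neg_smul,
        ← sub_eq_add_neg] at h
    rw [norm_twistedGaussian_mul_I, ← Real.exp_add, mul_assoc, mul_comm K, ← mul_assoc,
      ← Real.exp_add]
    refine mul_le_mul (Real.exp_le_exp.2 ?_) hdet (abs_nonneg _) (Real.exp_nonneg _)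
    have h1 : σ ^ 2 * (‖R z.1‖ ^ 2 + ‖R z.2‖ ^ 2) ≤ ‖R z.1‖ ^ 2 + ‖R z.2‖ ^ 2 :=
      mul_le_of_le_one_left (by positivity) hσ2
    linarith [hgrowth z.1, hgrowth z.2]
  have hint : Integrable fun z : E × E =>
      Real.exp C * K * (Real.exp (-(c / 2 * ‖z.1‖)) * Real.exp (-(c / 2 * ‖z.2‖))) :=
    ((integrable_exp_neg_mul_norm (half_pos hc)).mul_prod
      (integrable_exp_neg_mul_norm (half_pos hc))).const_mul _
  have hlim : Tendsto (fun σ : ℝ => ∫ z, twistedGaussian R z (σ * Complex.I)) (𝓝[<] 1)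
      (𝓝 (∫ z, twistedGaussian R z ((1 : ℝ) * Complex.I))) := by
    have hmem : Ioo (0 : ℝ) 1 ∈ 𝓝[<] (1 : ℝ) := Ioo_mem_nhdsLT one_pos
    refine tendsto_integral_filter_of_dominated_convergence _
      (Eventually.of_forall fun σ => ?_) ?_ hint (Eventually.of_forall fun z => ?_)
    · exact (((continuous_twistedGaussian hR).comp
        (continuous_id.prodMk continuous_const)).measurable).stronglyMeasurable.aestronglyMeasurable
    · filter_upwards [hmem] with σ hσ
      exact Eventually.of_forall (hbound σ hσ)
    · have hcz := (differentiable_twistedGaussian R z).continuous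
      have : Continuous fun σ : ℝ => twistedGaussian R z (σ * Complex.I) := by fun_prop
      exact (this.tendsto 1).mono_left nhdsWithin_le_nhds
  have hconst : Tendsto (fun σ : ℝ => ∫ z, twistedGaussian R z (σ * Complex.I)) (𝓝[<] 1)
      (𝓝 (((2 * Real.pi) ^ Module.finrank ℝ E : ℝ) : ℂ)) := by
    refine tendsto_const_nhds.congr' ?_
    filter_upwards [Ioo_mem_nhdsLT (one_pos : (0 : ℝ) < 1)] with σ hσ
    refine (integral_twistedGaussian hR h0 hlip ?_).symm
    simpa [abs_of_pos hσ.1] using hσ.2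
  have heq := tendsto_nhds_unique hlim hconst
  have hnorm := enorm_integral_le_lintegral_enorm (μ := (volume : Measure (E × E)))
    fun z => twistedGaussian R z ((1 : ℝ) * Complex.I)
  rw [heq, ← ofReal_norm, Complex.norm_real, Real.norm_of_nonneg (by positivity)] at hnorm
  refine hnorm.trans_eq (lintegral_congr fun z => ?_)
  rw [← ofReal_norm, norm_twistedGaussian_mul_I, one_pow, one_smul]
  congr 4
  ring

/-- A lower bound for the integral of `f`, from its values along the injective map
`(p, q) ↦ ((u - v)/2, (u + v)/2)` with `u = p - R q` and `v = q - R p`, whose Jacobian is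
`2⁻ⁿ |det (1 - DR(p) DR(q))|`. -/
theorem pi_pow_le_lintegral {R : E → E} (hR : ContDiff ℝ 1 R) (h0 : R 0 = 0)
    (hstrict : ∀ p p', p ≠ p' → ‖R p - R p'‖ < ‖p - p'‖) {c C : ℝ} (hc : 0 < c)
    (hgrowth : ∀ p, c * ‖p‖ - C ≤ ‖p‖ ^ 2 - ‖R p‖ ^ 2) {f : E × E → ENNReal}
    (hf : ∀ p q, ENNReal.ofReal
      (Real.exp (-((‖p‖ ^ 2 - ‖R p‖ ^ 2) + (‖q‖ ^ 2 - ‖R q‖ ^ 2)) / 2)) ≤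
      f ((1 / 2 : ℝ) • (p + R p) - (1 / 2 : ℝ) • (q + R q),
        (1 / 2 : ℝ) • (p - R p) + (1 / 2 : ℝ) • (q - R q))) :
    ENNReal.ofReal Real.pi ^ Module.finrank ℝ E ≤ ∫⁻ z, f z := by
  have hlip : LipschitzWith 1 R := LipschitzWith.of_dist_le_mul fun p p' => by
    rw [NNReal.coe_one, one_mul, dist_eq_norm, dist_eq_norm]
    rcases eq_or_ne p p' with rfl | h
    · simp
    · exact (hstrict p p' h).le
  set L : E × E →L[ℝ] E × E := blockCLM ((1 / 2 : ℝ) • 1) (-((1 / 2 : ℝ) • 1))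
    ((1 / 2 : ℝ) • 1) ((1 / 2 : ℝ) • 1) with hL
  set H : E × E → E × E := twistMap R (-1) (-1) with hH
  have hLapp : ∀ w : E × E, L w = ((1 / 2 : ℝ) • w.1 - (1 / 2 : ℝ) • w.2,
      (1 / 2 : ℝ) • w.1 + (1 / 2 : ℝ) • w.2) := fun w => by
    simp [hL, sub_eq_add_neg]
  have hLinj : Function.Injective L := by
    intro w w' h
    rw [hLapp, hLapp, Prod.mk.injEq] at h
    obtain ⟨h1, h2⟩ := h
    ext
    · have := congrArg₂ (· + ·) h1 h2
      simp only [sub_add_add_cancel, ← add_smul] at this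
      simpa using this
    · have := congrArg₂ (· - ·) h2 h1
      simp only [add_sub_sub_cancel, ← add_smul] at this
      simpa using this
  have hHinj : Function.Injective H := by
    intro w w' h
    simp only [hH, twistMap, Prod.mk.injEq, neg_smul, one_smul, ← sub_eq_add_neg] at h
    have h1 : w.1 - w'.1 = R w.2 - R w'.2 := by
      rw [sub_eq_sub_iff_add_eq_add] at h ⊢
      rw [h.1, add_comm]
    have h2 : w.2 - w'.2 = R w.1 - R w'.1 := by
      have := h.2
      rw [sub_eq_sub_iff_add_eq_add] at this ⊢
      rw [this, add_comm]
    -- otherwise `|w.1 - w'.1| = |R w.2 - R w'.2| ≤ |w.2 - w'.2| = |R w.1 - R w'.1| < |w.1 - w'.1|`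
    have key : w.1 = w'.1 := by
      by_contra hne
      have h3 := hstrict _ _ hne
      rw [← h2] at h3
      have h4 := hlip.dist_le_mul w.2 w'.2
      rw [NNReal.coe_one, one_mul, dist_eq_norm, dist_eq_norm, ← h1] at h4
      exact absurd h3 (not_lt.2 h4)
    rw [key, sub_self, sub_eq_zero] at h2
    exact Prod.ext key h2
  have hder : ∀ z ∈ (univ : Set (E × E)), HasFDerivWithinAt (L ∘ H)
      (L.comp (blockCLM 1 ((-1 : ℝ) • fderiv ℝ R z.2) ((-1 : ℝ) • fderiv ℝ R z.1) 1)) univ z :=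
    fun z _ => (L.hasFDerivAt.comp z
      (hasFDerivAt_twistMap (hR.differentiable one_ne_zero) (-1) (-1) z)).hasFDerivWithinAt
  have : (volume : Measure (E × E)).IsAddHaarMeasure := by
    rw [Measure.volume_eq_prod]; infer_instance
  have hcv := lintegral_image_eq_lintegral_abs_det_fderiv_mul (volume : Measure (E × E))
    MeasurableSet.univ hder (hLinj.comp hHinj).injOn f
  have hdet : ∀ z : E × E,
      (L.comp (blockCLM 1 ((-1 : ℝ) • fderiv ℝ R z.2) ((-1 : ℝ) • fderiv ℝ R z.1) 1)).det
        = (1 / 2) ^ Module.finrank ℝ E * (1 - fderiv ℝ R z.1 * fderiv ℝ R z.2).det := by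
    intro z
    have h1 := det_blockCLM_one_one ((-1 : ℝ) • fderiv ℝ R z.2) ((-1 : ℝ) • fderiv ℝ R z.1)
    rw [smul_mul_smul_comm, neg_one_mul, neg_neg, one_smul] at h1
    rw [← h1, ← det_blockCLM_rotation]
    exact LinearMap.det_comp _ _
  calc ENNReal.ofReal Real.pi ^ Module.finrank ℝ E
      = ENNReal.ofReal ((1 / 2) ^ Module.finrank ℝ E)
        * ENNReal.ofReal ((2 * Real.pi) ^ Module.finrank ℝ E) := by
        rw [← ENNReal.ofReal_mul (by positivity), ← mul_pow, ENNReal.ofReal_pow (by positivity)]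
        congr 2
        ring
    _ ≤ ENNReal.ofReal ((1 / 2) ^ Module.finrank ℝ E) * _ :=
        mul_le_mul_right (two_pi_pow_le_lintegral_det hR h0 hlip hc hgrowth) _
    _ = ∫⁻ z : E × E, ENNReal.ofReal ((1 / 2) ^ Module.finrank ℝ E) * ENNReal.ofReal
        (Real.exp (-((‖z.1‖ ^ 2 - ‖R z.1‖ ^ 2) + (‖z.2‖ ^ 2 - ‖R z.2‖ ^ 2)) / 2)
          * |(1 - fderiv ℝ R z.1 * fderiv ℝ R z.2).det|) :=
        (lintegral_const_mul' _ _ ENNReal.ofReal_ne_top).symm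
    _ ≤ ∫⁻ z in univ, ENNReal.ofReal |(L.comp (blockCLM 1 ((-1 : ℝ) • fderiv ℝ R z.2)
          ((-1 : ℝ) • fderiv ℝ R z.1) 1)).det| * f ((L ∘ H) z) := by
        rw [setLIntegral_univ]
        refine lintegral_mono fun z => ?_
        have hfz := hf z.1 z.2
        have hpt : (L ∘ H) z = ((1 / 2 : ℝ) • (z.1 + R z.1) - (1 / 2 : ℝ) • (z.2 + R z.2),
            (1 / 2 : ℝ) • (z.1 - R z.1) + (1 / 2 : ℝ) • (z.2 - R z.2)) := by
          rw [Function.comp_apply, hLapp]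
          simp only [hH, twistMap]
          ext1 <;> module
        rw [hpt, hdet, abs_mul, abs_of_pos (by positivity : (0 : ℝ) < (1 / 2) ^ _),
          mul_comm (Real.exp _), ENNReal.ofReal_mul (abs_nonneg _),
          ENNReal.ofReal_mul (by positivity : (0 : ℝ) ≤ (1 / 2) ^ _), mul_assoc]
        exact mul_le_mul_right (mul_le_mul_right hfz _) _
    _ = ∫⁻ z in (L ∘ H) '' univ, f z := hcv.symm
    _ ≤ ∫⁻ z, f z := setLIntegral_le_lintegral _ _

end TwistedGaussian

/-! ### Monotone maps and their Cayley transforms -/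

section MonotoneMaps

variable {E : Type*} [NormedAddCommGroup E] [InnerProductSpace ℝ E]

lemma inner_fderiv_nonneg_of_monotone {V : E → E} (hV : Differentiable ℝ V)
    (hmono : ∀ a b, 0 ≤ inner ℝ (V a - V b) (a - b)) (a v : E) :
    0 ≤ inner ℝ (fderiv ℝ V a v) v := by
  have hline : HasDerivAt (fun t : ℝ => a + t • v) v 0 := by
    simpa using ((hasDerivAt_id (0 : ℝ)).smul_const v).const_add a
  have hder : HasDerivAt (fun t : ℝ => inner ℝ (V (a + t • v)) v)
      (inner ℝ (fderiv ℝ V a v) v) 0 := by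
    have h := (HasFDerivAt.comp_hasDerivAt (0 : ℝ) (by simpa using (hV a).hasFDerivAt) hline).inner ℝ
      (hasDerivAt_const (0 : ℝ) v)
    simpa using h
  have hm : Monotone fun t : ℝ => inner ℝ (V (a + t • v)) v := by
    intro s t hst
    rcases hst.eq_or_lt with rfl | hst
    · exact le_rfl
    have h := hmono (a + t • v) (a + s • v)
    rw [add_sub_add_left_eq_sub, ← sub_smul, inner_smul_right, inner_sub_left] at h
    have := nonneg_of_mul_nonneg_right h (sub_pos.2 hst)
    simpa using this
  rw [← hder.deriv]
  exact hm.deriv_nonneg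

variable [FiniteDimensional ℝ E]

/-- The Cayley transform of a `C¹` monotone map `V`: the graph of `V` is parametrized by
`p = (a + V a) / 2`, and `R p = (a - V a) / 2` is a `C¹` function of `p`. -/
lemma exists_cayley_transform {V : E → E} (hV : ContDiff ℝ 1 V)
    (hmono : ∀ a b, 0 ≤ inner ℝ (V a - V b) (a - b)) :
    ∃ R : E → E, ContDiff ℝ 1 R ∧ (∀ p, V (p + R p) = p - R p) ∧
      ∀ a, R ((1 / 2 : ℝ) • (a + V a)) = (1 / 2 : ℝ) • (a - V a) := by
  set S : E → E := fun a => (1 / 2 : ℝ) • (a + V a) with hS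
  have hSc : ContDiff ℝ 1 S := contDiff_const.smul (contDiff_id.add hV)
  have hanti : AntilipschitzWith 2 S := by
    refine AntilipschitzWith.of_le_mul_dist fun a b => ?_
    have h1 : S a - S b = (1 / 2 : ℝ) • ((a - b) + (V a - V b)) := by
      simp only [hS]; module
    have h2 : ‖a - b‖ ^ 2 ≤ ‖(a - b) + (V a - V b)‖ ^ 2 := by
      rw [norm_add_sq_real, real_inner_comm]
      nlinarith [hmono a b, sq_nonneg ‖V a - V b‖]
    have h3 := (sq_le_sq₀ (norm_nonneg _) (norm_nonneg _)).1 h2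
    rw [dist_eq_norm, dist_eq_norm, h1, norm_smul]
    norm_num
    linarith
  have hderiv : ∀ a, HasFDerivAt S ((1 / 2 : ℝ) • (1 + fderiv ℝ V a)) a := fun a =>
    ((hasFDerivAt_id a).add ((hV.differentiable one_ne_zero) a).hasFDerivAt).const_smul _
  have hinj : ∀ a, Function.Injective ((1 / 2 : ℝ) • (1 + fderiv ℝ V a)).toLinearMap := fun a => by
    rw [← LinearMap.ker_eq_bot, LinearMap.ker_eq_bot']
    intro v hv
    have h1 : v + fderiv ℝ V a v = 0 :=
      (smul_eq_zero_iff_right (by norm_num : (1 / 2 : ℝ) ≠ 0)).1 hv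
    have h2 : inner ℝ (v + fderiv ℝ V a v) v = 0 := by rw [h1, inner_zero_left]
    rw [inner_add_left, real_inner_self_eq_norm_sq] at h2
    have h3 := inner_fderiv_nonneg_of_monotone (hV.differentiable one_ne_zero) hmono a v
    have h4 : ‖v‖ ^ 2 = 0 := le_antisymm (by linarith) (sq_nonneg _)
    simpa using h4
  set S' : E → E ≃L[ℝ] E := fun a =>
    (LinearEquiv.ofInjectiveEndo _ (hinj a)).toContinuousLinearEquiv
  have hS' : ∀ a, HasFDerivAt S (S' a : E →L[ℝ] E) a := fun a => by
    refine (hderiv a).congr_fderiv ?_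
    ext v
    rfl
  have hopen : IsOpenMap S := isOpenMap_of_hasStrictFDerivAt_equiv (f' := S') fun a =>
    hSc.contDiffAt.hasStrictFDerivAt' (hS' a) one_ne_zero
  have hclosed : IsClosed (range S) := by
    have hproper : IsProperMap S := isProperMap_iff_tendsto_cocompact.2
      ⟨hSc.continuous, by simpa only [← cobounded_eq_cocompact] using hanti.tendsto_cobounded⟩
    exact hproper.isClosedMap.isClosed_range
  have hsurj : Function.Surjective S := by
    rw [← range_eq_univ]
    exact IsClopen.eq_univ ⟨hclosed, hopen.isOpen_range⟩ (range_nonempty S)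
  set e : E ≃ₜ E := (Equiv.ofBijective S ⟨hanti.injective, hsurj⟩).toHomeomorphOfContinuousOpen
    hSc.continuous hopen
  have he : ContDiff ℝ 1 e.symm := e.contDiff_symm (f₀' := S') hS' hSc
  have heS : ∀ a, e.symm (S a) = a := fun a => e.symm_apply_apply a
  refine ⟨fun p => e.symm p - p, he.sub contDiff_id, fun p => ?_, fun a => ?_⟩
  · obtain ⟨a, rfl⟩ := hsurj p
    change V (S a + (e.symm (S a) - S a)) = S a - (e.symm (S a) - S a)
    rw [heS, add_sub_cancel]
    simp only [hS]
    module
  · change e.symm (S a) - S a = _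
    rw [heS]
    simp only [hS]
    module

/-- Strong monotonicity makes `V a · a` grow like `|a|²`, and monotonicity makes it grow at least like
`|V a|`. -/
lemma exists_linear_growth_of_strongly_monotone {V : E → E} (hV : Continuous V) {c : ℝ}
    (hc : 0 < c) (hmono : ∀ a b, c * ‖a - b‖ ^ 2 ≤ inner ℝ (V a - V b) (a - b)) (h0 : V 0 = 0) :
    ∃ C : ℝ, ∀ a, (‖a‖ + ‖V a‖) / 2 - C ≤ inner ℝ (V a) a := by
  obtain ⟨M, hM⟩ := (isCompact_closedBall (0 : E) 1).exists_bound_of_continuousOn hV.continuousOn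
  refine ⟨(M + (M + 1) ^ 2 / (4 * c)) / 2, fun a => ?_⟩
  have h1 : c * ‖a‖ ^ 2 ≤ inner ℝ (V a) a := by simpa [h0] using hmono a 0
  -- monotonicity against the unit vector in the direction of `V a`
  set b : E := ‖V a‖⁻¹ • V a with hb
  have hb1 : ‖b‖ ≤ 1 := by
    rw [hb, norm_smul, norm_inv, norm_norm]
    exact inv_mul_le_one
  have hb2 : inner ℝ (V a) b = ‖V a‖ := by
    rw [hb, inner_smul_right, real_inner_self_eq_norm_sq]
    rcases eq_or_ne ‖V a‖ 0 with h | h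
    · simp [h]
    · field_simp
  have h2 : 0 ≤ inner ℝ (V a - V b) (a - b) := le_trans (by positivity) (hmono a b)
  rw [inner_sub_left, inner_sub_right, hb2] at h2
  have h3 : -(M * (‖a‖ + 1)) ≤ inner ℝ (V b) (a - b) := by
    refine (neg_le_neg ?_).trans (neg_abs_le _)
    refine (abs_real_inner_le_norm _ _).trans (mul_le_mul (hM b (by simpa using hb1)) ?_
      (norm_nonneg _) ((norm_nonneg _).trans (hM b (by simpa using hb1))))
    exact (norm_sub_le _ _).trans (by linarith)
  have h4 : (M + 1) * ‖a‖ - (M + 1) ^ 2 / (4 * c) ≤ c * ‖a‖ ^ 2 := by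
    rw [sub_le_iff_le_add, ← sub_le_iff_le_add', le_div_iff₀ (by positivity)]
    nlinarith [sq_nonneg (2 * c * ‖a‖ - (M + 1))]
  linarith

end MonotoneMaps

/-! ### Strongly convex functions -/

section LegendreTransform

variable {n : ℕ} {φ : EuclideanSpace ℝ (Fin n) → ℝ}

lemma measurable_legendreTransform : Measurable (legendreTransform φ) := by
  refine LowerSemicontinuous.measurable (lowerSemicontinuous_iSup fun x => ?_)
  refine Continuous.lowerSemicontinuous ?_
  exact continuous_coe_real_ereal.comp (by fun_prop)

lemma ofReal_exp_neg_le_exp_neg_legendreTransform {ξ : EuclideanSpace ℝ (Fin n)} {M : ℝ}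
    (h : ∀ x, inner ℝ ξ x - φ x ≤ M) :
    ENNReal.ofReal (Real.exp (-M)) ≤ EReal.exp (-legendreTransform φ ξ) := by
  rw [← EReal.exp_coe, EReal.exp_le_exp_iff, EReal.coe_neg, EReal.neg_le_neg_iff]
  exact iSup_le fun x => EReal.coe_le_coe_iff.2 (h x)

lemma exp_neg_legendreTransform_le (ξ x : EuclideanSpace ℝ (Fin n)) :
    EReal.exp (-legendreTransform φ ξ) ≤ ENNReal.ofReal (Real.exp (φ x - inner ℝ ξ x)) := by
  rw [← EReal.exp_coe, EReal.exp_le_exp_iff, ← neg_sub (inner ℝ ξ x), EReal.coe_neg,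
    EReal.neg_le_neg_iff]
  exact le_iSup (fun x => ((inner ℝ ξ x - φ x : ℝ) : EReal)) x

lemma le_exp_neg_legendreTransform {ξ : EuclideanSpace ℝ (Fin n)} {a : ENNReal}
    (h : ∀ x, a ≤ ENNReal.ofReal (Real.exp (φ x - inner ℝ ξ x))) :
    a ≤ EReal.exp (-legendreTransform φ ξ) := by
  rw [← EReal.expOrderIso_apply, ← OrderIso.symm_apply_le, EReal.le_neg]
  refine iSup_le fun x => ?_
  rw [EReal.le_neg, ← EReal.coe_neg, neg_sub, OrderIso.symm_apply_le, EReal.expOrderIso_apply,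
    EReal.exp_coe]
  exact h x

/-- The inequality for a strongly convex function with `C¹` gradient `V`. In the coordinates
`a = p + R p`, `b = q + R q` of the Cayley transform of `V`, the function `e^{-φ(x) - φ*(y)}` is
tested at `x = (a - b)/2`, `y = (V a + V b)/2`. -/
theorem pi_pow_le_of_strongly_convex {V : EuclideanSpace ℝ (Fin n) → EuclideanSpace ℝ (Fin n)}
    (hconv : ConvexOn ℝ univ φ) (heven : Function.Even φ) (hφ : Continuous φ)
    (hV : ContDiff ℝ 1 V) (h0 : V 0 = 0)
    {c : ℝ} (hc : 0 < c) (hsub : ∀ x y, φ x + inner ℝ (V x) (y - x) + c * ‖y - x‖ ^ 2 ≤ φ y) :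
    ENNReal.ofReal Real.pi ^ n ≤
      integralExpNeg (fun x => (φ x : EReal)) * integralExpNeg (legendreTransform φ) := by
  have hmono : ∀ a b, c * ‖a - b‖ ^ 2 ≤ inner ℝ (V a - V b) (a - b) := by
    intro a b
    have h1 := hsub a b
    have h2 := hsub b a
    rw [← neg_sub a b, inner_neg_right, norm_neg] at h1
    rw [inner_sub_left]
    have : 0 ≤ c * ‖a - b‖ ^ 2 := by positivity
    linarith
  obtain ⟨R, hR, hVR, hRV⟩ := exists_cayley_transform hV fun a b =>
    le_trans (by positivity) (hmono a b)
  obtain ⟨C, hC⟩ := exists_linear_growth_of_strongly_monotone hV.continuous hc hmono h0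
  have hR0 : R 0 = 0 := by simpa [h0] using hRV 0
  have hinner : ∀ p, ‖p‖ ^ 2 - ‖R p‖ ^ 2 = inner ℝ (V (p + R p)) (p + R p) := fun p => by
    rw [hVR, inner_add_right, inner_sub_left, inner_sub_left, real_inner_self_eq_norm_sq,
      real_inner_self_eq_norm_sq, real_inner_comm]
    ring
  have hstrict : ∀ p p', p ≠ p' → ‖R p - R p'‖ < ‖p - p'‖ := by
    intro p p' hne
    have h1 := hmono (p + R p) (p' + R p')
    have h2 : inner ℝ (V (p + R p) - V (p' + R p')) (p + R p - (p' + R p'))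
        = ‖p - p'‖ ^ 2 - ‖R p - R p'‖ ^ 2 := by
      have e1 : V (p + R p) - V (p' + R p') = (p - p') - (R p - R p') := by
        rw [hVR, hVR]; abel
      have e2 : p + R p - (p' + R p') = (p - p') + (R p - R p') := by abel
      rw [e1, e2]
      generalize p - p' = u
      generalize R p - R p' = v
      rw [inner_add_right, inner_sub_left, inner_sub_left, real_inner_self_eq_norm_sq,
        real_inner_self_eq_norm_sq, real_inner_comm]
      ring
    have h3 : p + R p ≠ p' + R p' := by
      intro h
      have h4 : p - R p = p' - R p' := by rw [← hVR, ← hVR, h]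
      apply hne
      have h5 := congrArg₂ (· + ·) h h4
      simp only [add_add_sub_cancel, ← two_smul ℝ] at h5
      exact smul_right_injective _ two_ne_zero h5
    have h6 : 0 < ‖p + R p - (p' + R p')‖ := norm_pos_iff.2 (sub_ne_zero.2 h3)
    have h7 : 0 < c * ‖p + R p - (p' + R p')‖ ^ 2 := by positivity
    exact lt_of_pow_lt_pow_left₀ 2 (norm_nonneg _) (by linarith)
  have hgrowth : ∀ p, 1 * ‖p‖ - C ≤ ‖p‖ ^ 2 - ‖R p‖ ^ 2 := fun p => by
    rw [hinner]
    refine le_trans ?_ (hC _)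
    have h1 : p = (1 / 2 : ℝ) • ((p + R p) + V (p + R p)) := by rw [hVR]; module
    have h2 : ‖p‖ ≤ (‖p + R p‖ + ‖V (p + R p)‖) / 2 := by
      calc ‖p‖ = ‖(1 / 2 : ℝ) • ((p + R p) + V (p + R p))‖ := by rw [← h1]
        _ = 1 / 2 * ‖(p + R p) + V (p + R p)‖ := by rw [norm_smul]; norm_num
        _ ≤ _ := by linarith [norm_add_le (p + R p) (V (p + R p))]
    linarith
  have hmeasφ : Measurable fun x => EReal.exp (-(φ x : EReal)) := by
    have : (fun x => EReal.exp (-(φ x : EReal))) = fun x => ENNReal.ofReal (Real.exp (-φ x)) := by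
      ext x; rw [← EReal.coe_neg, EReal.exp_coe]
    rw [this]
    fun_prop
  have hmeasL : Measurable fun y => EReal.exp (-legendreTransform φ y) :=
    EReal.measurable_exp.comp measurable_legendreTransform.neg
  have key := pi_pow_le_lintegral hR hR0 hstrict one_pos hgrowth
    (f := fun z => EReal.exp (-(φ z.1 : EReal)) * EReal.exp (-legendreTransform φ z.2)) ?_
  · rw [finrank_euclideanSpace_fin, Measure.volume_eq_prod, lintegral_prod_mul
      (f := fun x => EReal.exp (-(φ x : EReal))) (g := fun y => EReal.exp (-legendreTransform φ y))
      hmeasφ.aemeasurable hmeasL.aemeasurable] at key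
    exact key
  · intro p q
    rw [hinner, hinner, ← hVR, ← hVR]
    set a := p + R p
    set b := q + R q
    -- evenness enters here: `b` is replaced by `-b`
    have h1 : φ ((1 / 2 : ℝ) • a - (1 / 2 : ℝ) • b) ≤ (φ a + φ b) / 2 := by
      have h := hconv.2 (mem_univ a) (mem_univ (-b)) (by norm_num : (0 : ℝ) ≤ 1 / 2)
        (by norm_num : (0 : ℝ) ≤ 1 / 2) (by norm_num)
      rw [smul_neg, ← sub_eq_add_neg, heven b, smul_eq_mul, smul_eq_mul] at h
      linarith
    have h2 : ∀ x, inner ℝ ((1 / 2 : ℝ) • V a + (1 / 2 : ℝ) • V b) x - φ x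
        ≤ (inner ℝ (V a) a - φ a + (inner ℝ (V b) b - φ b)) / 2 := by
      intro x
      have ha := hsub a x
      have hb := hsub b x
      rw [inner_sub_right] at ha hb
      rw [inner_add_left, inner_smul_left, inner_smul_left]
      have : 0 ≤ c * ‖x - a‖ ^ 2 := by positivity
      have : 0 ≤ c * ‖x - b‖ ^ 2 := by positivity
      simp
      linarith
    refine le_trans ?_ (mul_le_mul_right (ofReal_exp_neg_le_exp_neg_legendreTransform h2) _)
    rw [← EReal.coe_neg, EReal.exp_coe, ← ENNReal.ofReal_mul (Real.exp_nonneg _), ← Real.exp_add]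
    refine ENNReal.ofReal_le_ofReal (Real.exp_le_exp.2 ?_)
    linarith

end LegendreTransform

/-! ### Smoothing of convex functions -/

section ConvexGradient

variable {E : Type*} [NormedAddCommGroup E] [InnerProductSpace ℝ E] [CompleteSpace E]

lemma ConvexOn.add_inner_gradient_le {ψ : E → ℝ} (hconv : ConvexOn ℝ univ ψ)
    (hψ : Differentiable ℝ ψ) (x y : E) : ψ x + inner ℝ (gradient ψ x) (y - x) ≤ ψ y := by
  have hline : HasDerivAt (fun t : ℝ => AffineMap.lineMap x y t) (y - x) 0 :=
    AffineMap.hasDerivAt_lineMap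
  have hder : HasDerivAt (fun t : ℝ => ψ (AffineMap.lineMap x y t))
      (inner ℝ (gradient ψ x) (y - x)) 0 := by
    refine HasFDerivAt.comp_hasDerivAt (f := fun t : ℝ => AffineMap.lineMap x y t) (0 : ℝ)
      (l' := InnerProductSpace.toDual ℝ E (gradient ψ x)) ?_ hline
    simpa only [AffineMap.lineMap_apply_zero] using (hψ x).hasGradientAt.hasFDerivAt
  have hc : ConvexOn ℝ univ fun t : ℝ => ψ (AffineMap.lineMap x y t) :=
    hconv.comp_affineMap (AffineMap.lineMap x y : ℝ →ᵃ[ℝ] E)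
  have h := hc.le_slope_of_hasDerivAt (mem_univ 0) (mem_univ 1) one_pos hder
  simp only [slope_def_field, AffineMap.lineMap_apply_zero, AffineMap.lineMap_apply_one, sub_zero,
    div_one] at h
  linarith

end ConvexGradient

section Mollification

variable {E : Type*} [NormedAddCommGroup E] [InnerProductSpace ℝ E] [FiniteDimensional ℝ E]
  [MeasurableSpace E] [BorelSpace E]

/-- The average of `φ` over translations, weighted by a smooth bump function. -/
noncomputable def mollify (ρ : ContDiffBump (0 : E)) (φ : E → ℝ) (x : E) : ℝ :=
  (ρ.normed volume ⋆[ContinuousLinearMap.lsmul ℝ ℝ, volume] φ) x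

variable {ρ : ContDiffBump (0 : E)} {φ : E → ℝ}

lemma mollify_eq (x : E) : mollify ρ φ x = ∫ t, ρ.normed volume t * φ (x - t) := rfl

/-- The weight is symmetric. -/
lemma mollify_eq' (x : E) : mollify ρ φ x = ∫ t, ρ.normed volume t * φ (x + t) := by
  rw [mollify_eq, ← integral_neg_eq_self]
  simp only [ρ.normed_neg, sub_neg_eq_add]

lemma integrable_normed_mul {g : E → ℝ} (hg : Continuous g) :
    Integrable fun t => ρ.normed volume t * g t :=
  (ρ.continuous_normed.mul hg).integrable_of_hasCompactSupport
    ρ.hasCompactSupport_normed.mul_right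

lemma contDiff_mollify (hφ : Continuous φ) : ContDiff ℝ 2 (mollify ρ φ) :=
  ρ.hasCompactSupport_normed.contDiff_convolution_left (n := 2) _ ρ.contDiff_normed
    hφ.locallyIntegrable

lemma mollify_even (heven : Function.Even φ) : Function.Even (mollify ρ φ) := fun x => by
  rw [mollify_eq, mollify_eq']
  refine integral_congr_ae (Eventually.of_forall fun t => ?_)
  simp only
  rw [← heven (x + t), neg_add, sub_eq_add_neg]

lemma convexOn_mollify (hconv : ConvexOn ℝ univ φ) (hφ : Continuous φ) :
    ConvexOn ℝ univ (mollify ρ φ) := by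
  refine ⟨convex_univ, fun x _ y _ a b ha hb hab => ?_⟩
  have hx : Integrable fun t => ρ.normed volume t * φ (x - t) :=
    integrable_normed_mul (by fun_prop)
  have hy : Integrable fun t => ρ.normed volume t * φ (y - t) :=
    integrable_normed_mul (by fun_prop)
  rw [mollify_eq, mollify_eq, mollify_eq, smul_eq_mul, smul_eq_mul, ← integral_const_mul,
    ← integral_const_mul, ← integral_add (hx.const_mul a) (hy.const_mul b)]
  refine integral_mono (integrable_normed_mul (by fun_prop))
    ((hx.const_mul a).add (hy.const_mul b)) fun t => ?_
  have h := hconv.2 (mem_univ (x - t)) (mem_univ (y - t)) ha hb hab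
  have hpt : a • (x - t) + b • (y - t) = a • x + b • y - t := by
    rw [smul_sub, smul_sub, sub_add_sub_comm, ← add_smul, hab, one_smul]
  rw [hpt, smul_eq_mul, smul_eq_mul] at h
  have := mul_le_mul_of_nonneg_left h (ρ.nonneg_normed (μ := volume) t)
  simp only
  linarith

/-- Jensen's inequality for the symmetric weight `ρ`. -/
lemma le_mollify (hconv : ConvexOn ℝ univ φ) (hφ : Continuous φ) (x : E) :
    φ x ≤ mollify ρ φ x := by
  have h1 : Integrable fun t => ρ.normed volume t * φ (x - t) :=
    integrable_normed_mul (by fun_prop)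
  have h2 : Integrable fun t => ρ.normed volume t * φ (x + t) :=
    integrable_normed_mul (by fun_prop)
  have h3 : φ x = ∫ t, ρ.normed volume t * φ x := by
    rw [integral_mul_const, ρ.integral_normed, one_mul]
  have h4 : mollify ρ φ x = ∫ t, 1 / 2 * (ρ.normed volume t * φ (x - t)
      + ρ.normed volume t * φ (x + t)) := by
    rw [integral_const_mul, integral_add h1 h2, ← mollify_eq, ← mollify_eq']
    ring
  rw [h3, h4]
  refine integral_mono (integrable_normed_mul continuous_const) ((h1.add h2).const_mul _)
    fun t => ?_
  have h := hconv.2 (mem_univ (x - t)) (mem_univ (x + t)) (by norm_num : (0 : ℝ) ≤ 1 / 2)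
    (by norm_num : (0 : ℝ) ≤ 1 / 2) (by norm_num)
  have hpt : (1 / 2 : ℝ) • (x - t) + (1 / 2 : ℝ) • (x + t) = x := by module
  rw [hpt, smul_eq_mul, smul_eq_mul] at h
  have := mul_le_mul_of_nonneg_left h (ρ.nonneg_normed (μ := volume) t)
  simp only
  linarith

lemma mollify_le (hφ : Continuous φ) {x : E} {M : ℝ}
    (hM : ∀ t, ‖t‖ ≤ ρ.rOut → φ (x - t) ≤ M) : mollify ρ φ x ≤ M := by
  have h3 : M = ∫ t, ρ.normed volume t * M := by
    rw [integral_mul_const, ρ.integral_normed, one_mul]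
  rw [mollify_eq, h3]
  refine integral_mono (integrable_normed_mul (by fun_prop))
    (integrable_normed_mul continuous_const) fun t => ?_
  by_cases ht : ‖t‖ ≤ ρ.rOut
  · exact mul_le_mul_of_nonneg_left (hM t ht) (ρ.nonneg_normed t)
  · have h0 : ρ.normed volume t = 0 := by
      rw [← Function.notMem_support, ρ.support_normed_eq]
      simpa using (not_le.1 ht).le
    simp [h0]

end Mollification

/-! ### The general inequality -/

section Main

variable {n : ℕ} {φ : EuclideanSpace ℝ (Fin n) → ℝ}

/-- The inequality for `ψ + c|x|²`, with `ψ` even, convex and of class `C²`. -/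
theorem pi_pow_le_of_contDiff_add_sq {ψ : EuclideanSpace ℝ (Fin n) → ℝ}
    (hconv : ConvexOn ℝ univ ψ) (heven : Function.Even ψ) (hψ : ContDiff ℝ 2 ψ)
    {c : ℝ} (hc : 0 < c) :
    ENNReal.ofReal Real.pi ^ n ≤
      integralExpNeg (fun x => ((ψ x + c * ‖x‖ ^ 2 : ℝ) : EReal)) *
        integralExpNeg (legendreTransform fun x => ψ x + c * ‖x‖ ^ 2) := by
  have hd : Differentiable ℝ ψ := hψ.differentiable two_ne_zero
  have hgrad : ContDiff ℝ 1 (gradient ψ) :=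
    (InnerProductSpace.toDual ℝ (EuclideanSpace ℝ (Fin n))).symm.contDiff.comp
      (hψ.fderiv_right (m := 1) (by norm_num))
  have hmin : IsLocalMin ψ 0 := Eventually.of_forall fun x => by
    have h := hconv.2 (mem_univ x) (mem_univ (-x)) (by norm_num : (0 : ℝ) ≤ 1 / 2)
      (by norm_num : (0 : ℝ) ≤ 1 / 2) (by norm_num)
    rw [heven x, smul_neg, add_neg_cancel, smul_eq_mul] at h
    linarith
  have hgrad0 : gradient ψ 0 = 0 := by
    rw [gradient, hmin.fderiv_eq_zero, map_zero]
  have hsqconv : ConvexOn ℝ univ fun x : EuclideanSpace ℝ (Fin n) => c * ‖x‖ ^ 2 :=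
    ((convexOn_norm convex_univ).pow (fun _ _ => norm_nonneg _) 2).smul hc.le
  refine pi_pow_le_of_strongly_convex (V := fun x => gradient ψ x + (2 * c) • x)
    (hconv.add hsqconv) (fun x => by rw [heven x, norm_neg])
    (by have := hψ.continuous; fun_prop) (hgrad.add (contDiff_id.const_smul (2 * c)))
    (by rw [hgrad0, smul_zero, add_zero]) hc fun x y => ?_
  have h1 := hconv.add_inner_gradient_le hd x y
  have h2 : ‖y‖ ^ 2 = ‖x‖ ^ 2 + 2 * inner ℝ x (y - x) + ‖y - x‖ ^ 2 := by
    rw [← norm_add_sq_real, add_sub_cancel]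
  rw [inner_add_left, inner_smul_left, h2]
  simp only [conj_trivial]
  linarith

/-- Upper semicontinuity of `φ ↦ ∫ e^{-φ*}` under pointwise convergence of functions that are
uniformly bounded above on the unit ball. -/
lemma limsup_integralExpNeg_legendreTransform_le {Φ : ℕ → EuclideanSpace ℝ (Fin n) → ℝ} {M : ℝ}
    (hM : ∀ k x, ‖x‖ ≤ 1 → Φ k x ≤ M) (hlim : ∀ x, Tendsto (fun k => Φ k x) atTop (𝓝 (φ x))) :
    limsup (fun k => integralExpNeg (legendreTransform (Φ k))) atTop
      ≤ integralExpNeg (legendreTransform φ) := by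
  have hbound : ∀ k ξ, EReal.exp (-legendreTransform (Φ k) ξ)
      ≤ ENNReal.ofReal (Real.exp M * Real.exp (-(1 * ‖ξ‖))) := by
    intro k ξ
    -- test the supremum at the unit vector in the direction of `ξ`
    refine (exp_neg_legendreTransform_le ξ (‖ξ‖⁻¹ • ξ)).trans
      (ENNReal.ofReal_le_ofReal ?_)
    rw [← Real.exp_add]
    refine Real.exp_le_exp.2 ?_
    have h1 : ‖‖ξ‖⁻¹ • ξ‖ ≤ 1 := by
      rw [norm_smul, norm_inv, norm_norm]
      exact inv_mul_le_one
    have h2 : inner ℝ ξ (‖ξ‖⁻¹ • ξ) = ‖ξ‖ := by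
      rw [inner_smul_right, real_inner_self_eq_norm_sq]
      rcases eq_or_ne ‖ξ‖ 0 with h | h
      · simp [h]
      · field_simp
    rw [h2]
    linarith [hM k _ h1]
  have hint : Integrable fun ξ : EuclideanSpace ℝ (Fin n) =>
      Real.exp M * Real.exp (-(1 * ‖ξ‖)) := (integrable_exp_neg_mul_norm one_pos).const_mul _
  refine (limsup_lintegral_le _ (fun k => EReal.measurable_exp.comp
    measurable_legendreTransform.neg) (fun k => Eventually.of_forall (hbound k))
    hint.lintegral_lt_top.ne).trans (lintegral_mono fun ξ => ?_)
  refine le_exp_neg_legendreTransform fun x => ?_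
  have ht : Tendsto (fun k => ENNReal.ofReal (Real.exp (Φ k x - inner ℝ ξ x))) atTop
      (𝓝 (ENNReal.ofReal (Real.exp (φ x - inner ℝ ξ x)))) :=
    ENNReal.tendsto_ofReal ((Real.continuous_exp.tendsto _).comp ((hlim x).sub_const _))
  rw [← ht.limsup_eq]
  exact limsup_le_limsup (Eventually.of_forall fun k => exp_neg_legendreTransform_le ξ x)

end Main

/-- For an even convex function `φ` on `ℝⁿ`, `∫ e^{-φ} · ∫ e^{-φ*} ≥ πⁿ`, provided that the product
is not the undefined expression `∞ · 0`. -/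
theorem theorem2p1 (n : ℕ) (φ : EuclideanSpace ℝ (Fin n) → ℝ)
    (hconv : ConvexOn ℝ Set.univ φ) (heven : Function.Even φ)
    (hdef : ¬ (integralExpNeg (fun x => (φ x : EReal)) = ⊤ ∧
      integralExpNeg (legendreTransform φ) = 0)) :
    ENNReal.ofReal Real.pi ^ n ≤
      integralExpNeg (fun x => (φ x : EReal)) * integralExpNeg (legendreTransform φ) := by
  rcases eq_or_ne (integralExpNeg fun x => (φ x : EReal)) ⊤ with htop | htop
  · rw [htop, ENNReal.top_mul fun h => hdef ⟨htop, h⟩]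
    exact le_top
  have hφ : Continuous φ := continuousOn_univ.1 (hconv.continuousOn isOpen_univ)
  set ε : ℕ → ℝ := fun k => 1 / ((k : ℝ) + 1)
  have hε : ∀ k, 0 < ε k := fun k => Nat.one_div_pos_of_nat
  have hε1 : ∀ k, ε k ≤ 1 := fun k => by
    simpa [ε] using Nat.one_div_le_one_div (α := ℝ) (Nat.zero_le k)
  have hεlim : Tendsto ε atTop (𝓝 0) := tendsto_one_div_add_atTop_nhds_zero_nat
  set ρ : ℕ → ContDiffBump (0 : EuclideanSpace ℝ (Fin n)) := fun k =>
    ⟨ε k / 2, ε k, half_pos (hε k), half_lt_self (hε k)⟩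
  set Φ : ℕ → EuclideanSpace ℝ (Fin n) → ℝ := fun k x => mollify (ρ k) φ x + ε k * ‖x‖ ^ 2
  have hle : ∀ k x, φ x ≤ Φ k x := fun k x => by
    have := le_mollify (ρ := ρ k) hconv hφ x
    have : 0 ≤ ε k * ‖x‖ ^ 2 := mul_nonneg (hε k).le (sq_nonneg _)
    simp only [Φ]
    linarith
  have hlim : ∀ x, Tendsto (fun k => Φ k x) atTop (𝓝 (φ x)) := fun x => by
    have h1 : Tendsto (fun k => mollify (ρ k) φ x) atTop (𝓝 (φ x)) :=
      ContDiffBump.convolution_tendsto_right_of_continuous hεlim hφ x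
    simpa using h1.add (hεlim.mul_const (‖x‖ ^ 2))
  obtain ⟨M, hM⟩ := (isCompact_closedBall (0 : EuclideanSpace ℝ (Fin n)) 2
    ).exists_bound_of_continuousOn hφ.continuousOn
  have hΦM : ∀ k x, ‖x‖ ≤ 1 → Φ k x ≤ M + 1 := fun k x hx => by
    refine add_le_add (mollify_le hφ fun t ht => (le_abs_self _).trans (hM _ ?_)) ?_
    · have : ‖t‖ ≤ 1 := ht.trans (hε1 k)
      rw [mem_closedBall_zero_iff]
      linarith [norm_sub_le x t]
    · exact mul_le_one₀ (hε1 k) (sq_nonneg _) (pow_le_one₀ (norm_nonneg _) hx)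
  set I := integralExpNeg fun x => (φ x : EReal)
  have hk : ∀ k, ENNReal.ofReal Real.pi ^ n ≤ I * integralExpNeg (legendreTransform (Φ k)) := by
    intro k
    refine (pi_pow_le_of_contDiff_add_sq (convexOn_mollify hconv hφ) (mollify_even heven)
      (contDiff_mollify (ρ := ρ k) hφ) (hε k)).trans (mul_le_mul_left ?_ _)
    exact lintegral_mono fun x => EReal.exp_le_exp_iff.2
      (EReal.neg_le_neg_iff.2 (EReal.coe_le_coe_iff.2 (hle k x)))
  calc ENNReal.ofReal Real.pi ^ n
      ≤ limsup (fun k => I * integralExpNeg (legendreTransform (Φ k))) atTop :=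
        le_limsup_of_frequently_le (Eventually.of_forall hk).frequently
    _ = I * limsup (fun k => integralExpNeg (legendreTransform (Φ k))) atTop :=
        ENNReal.limsup_const_mul_of_ne_top htop
    _ ≤ I * integralExpNeg (legendreTransform φ) :=
        mul_le_mul_right (limsup_integralExpNeg_legendreTransform_le hΦM hlim) _
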